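/- There is an absolute constant $C>0$ such that the following holds. Let $m\ge 0$, $\ell\ge 1$ and $N\ge 0$ be integers with $N\ge C\ell m$. Write $[N]=\{1,\dots,N\}$ and let $\binom{[N]}{k}$ denote the set of all $k$-element subsets of $[N]$. Let $G$ be a finite simple graph with exactly $m$ edges and no isolated vertices, and let $f:\binom{[N]}{2}\to\binom{[N]}{\ell}$ be a function such that $f(e)\cap e=\emptyset$ for every $e\in\binom{[N]}{2}$. Then there is an injection $\varphi:V(G)\to[N]$ such that $f(\{\varphi(u),\varphi(v)\})\cap\varphi(V(G))=\emptyset$ for every edge $uv\in E(G)$. -/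

import Mathlib

/-- The pair `{a, b}` of two distinct elements, as a two-element subset. -/
def pairOf {α : Type*} [DecidableEq α] (a b : α) (h : a ≠ b) : Set.powersetCard α 2 :=
  ⟨{a, b}, Finset.card_pair h⟩

/-! Embed greedily, always taking the unplaced vertex `q` that maximizes degree over slack. The
potential `Ψ = ∑ deg v / a v` over unplaced vertices starts at `2m`. Removing `q` frees `deg q / a
q`, and its image is chosen so that the slack lost elsewhere costs at most half of that
(`sum_degree_div_slack_le`). So each step lowers `Ψ` by at least `deg v / 2` for every `v` left. As
`Ψ ≥ 0`, a vertex `v` still unplaced after `s` steps has `s * deg v ≤ 4m`: high degrees go early,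
when few images can conflict. This keeps the points forbidden for each vertex below a fixed fraction
of `N`, and averaging over all points then yields an image (`IsGoodPartial.exists_image`). -/

open Finset in
/-- The number of points `x` such that `w` belongs to the set assigned to the pair `u, x`. -/
def forbiddenCount {α : Type*} [Fintype α] [DecidableEq α] (g : α → α → Finset α) (u w : α) : ℕ :=
  #{x | w ∈ g u x}

/-- The total number of pairs `u, x` whose assigned set contains `w`. -/
def popularity {α : Type*} [Fintype α] [DecidableEq α] (g : α → α → Finset α) (w : α) : ℕ :=
  ∑ u, forbiddenCount g u w

/-! ### Double counting of forbidden points -/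

section Counting

open Finset

variable {α : Type*} [Fintype α] [DecidableEq α] {g : α → α → Finset α} {l : ℕ}

theorem sum_forbiddenCount_le (hg : ∀ x y, #(g x y) ≤ l) (u : α) :
    ∑ w, (forbiddenCount g u w : ℝ) ≤ l * Fintype.card α := by
  have h : ∑ w, forbiddenCount g u w = ∑ x, #(g u x) := by
    simp only [forbiddenCount, card_eq_sum_ones, sum_filter]
    rw [sum_comm]
    simp
  have h2 : ∑ w, forbiddenCount g u w ≤ l * Fintype.card α := by
    rw [h]
    calc ∑ x, #(g u x) ≤ ∑ _x : α, l := sum_le_sum fun x _ => hg u x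
      _ = l * Fintype.card α := by simp [mul_comm]
  exact_mod_cast h2

theorem sum_popularity_le (hg : ∀ x y, #(g x y) ≤ l) :
    ∑ w, (popularity g w : ℝ) ≤ l * Fintype.card α * Fintype.card α := by
  simp only [popularity, Nat.cast_sum]
  rw [sum_comm]
  calc ∑ u, ∑ w, (forbiddenCount g u w : ℝ) ≤ ∑ _u : α, (l * Fintype.card α : ℝ) :=
        sum_le_sum fun u _ => sum_forbiddenCount_le hg u
    _ = l * Fintype.card α * Fintype.card α := by simp [mul_comm]

theorem sum_indicator_mem_right (u w : α) :
    ∑ x, (if w ∈ g u x then (1 : ℝ) else 0) = forbiddenCount g u w := by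
  simp [forbiddenCount]

theorem forbiddenCount_self (hx : ∀ x y, x ∉ g x y) (x : α) : forbiddenCount g x x = 0 := by
  simp [forbiddenCount, hx]

end Counting

/-- Makes the growth of `deg v / a v` linear in the slack lost, so that it can be averaged over
images. -/
theorem inv_sub_le_inv_add {a t : ℝ} (ha : 0 < a) (ht : 0 ≤ t) (hta : t ≤ a / 2) :
    (a - t)⁻¹ ≤ a⁻¹ + 2 * t / a ^ 2 := by
  have h1 : 0 < a - t := by linarith
  rw [inv_le_iff_one_le_mul₀ h1]
  have e : (a⁻¹ + 2 * t / a ^ 2) * (a - t) = 1 + t * (a - 2 * t) / a ^ 2 := by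
    field_simp
    ring
  rw [e]
  have : 0 ≤ t * (a - 2 * t) / a ^ 2 := div_nonneg (mul_nonneg ht (by linarith)) (by positivity)
  linarith

open Finset in
theorem sum_update_of_notMem {V α : Type*} [DecidableEq V] {S : Finset V} {φ : V → α}
    {q : V} (hq : q ∉ S) (x : α) (F : α → ℝ) :
    ∑ w ∈ insert q S, F (Function.update φ q x w) = F x + ∑ w ∈ S, F (φ w) := by
  rw [sum_insert hq, Function.update_self]
  congr 1
  refine sum_congr rfl fun w hw => ?_
  rw [Function.update_of_ne (ne_of_mem_of_not_mem hw hq)]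

/-! ### Slack losses and their averages -/

section Greedy

open Finset

variable {V α : Type*} [Fintype α] [DecidableEq α]
  (G : SimpleGraph V) [DecidableRel G.Adj] (g : α → α → Finset α)

/-- The relative increase of the number of points forbidden for `v` when `x` becomes an image. -/
noncomputable def slackLoss (S : Finset V) (φ : V → α) (v : V) (x : α) : ℝ :=
  4 / Fintype.card α * ∑ u ∈ S with G.Adj v u, (forbiddenCount g (φ u) x : ℝ)

variable {G g} {l m : ℕ}

theorem slackLoss_nonneg (S : Finset V) (φ : V → α) (v : V) (x : α) :
    0 ≤ slackLoss G g S φ v x := by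
  unfold slackLoss; positivity

theorem sum_indicator_eq_le (S : Finset V) (φ : V → α) :
    ∑ x, ∑ w ∈ S, (if φ w = x then (1 : ℝ) else 0) = #S := by
  rw [sum_comm]; simp

theorem sum_indicator_mem_new_edge (S : Finset V) (φ : V → α) (q : V) :
    ∑ x, ∑ u ∈ S with G.Adj q u, ∑ w ∈ S, (if φ w ∈ g (φ u) x then (1 : ℝ) else 0) =
      ∑ u ∈ S with G.Adj q u, ∑ w ∈ S, (forbiddenCount g (φ u) (φ w) : ℝ) := by
  rw [sum_comm]
  refine sum_congr rfl fun u _ => ?_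
  rw [sum_comm]
  exact sum_congr rfl fun w _ => sum_indicator_mem_right _ _

theorem sum_sum_forbiddenCount_eq (S : Finset V) (φ : V → α) :
    ∑ x, ∑ w ∈ S, (forbiddenCount g x (φ w) : ℝ) = ∑ w ∈ S, (popularity g (φ w) : ℝ) := by
  rw [sum_comm]; simp [popularity]

variable [Fintype V]

theorem card_filter_adj_le_degree (S : Finset V) (v : V) :
    #{u ∈ S | G.Adj v u} ≤ G.degree v := by
  rw [← G.card_neighborFinset_eq_degree]
  exact card_le_card fun u hu => by simpa using (mem_filter.1 hu).2

theorem sum_slackLoss_le [Nonempty α] (hg : ∀ x y, #(g x y) ≤ l) (S : Finset V) (φ : V → α)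
    (v : V) : ∑ x, slackLoss G g S φ v x ≤ 4 * l * G.degree v := by
  have hN : (0 : ℝ) < Fintype.card α := by exact_mod_cast Fintype.card_pos
  unfold slackLoss
  rw [← mul_sum, sum_comm]
  calc 4 / (Fintype.card α : ℝ) * ∑ u ∈ S with G.Adj v u, ∑ x, (forbiddenCount g (φ u) x : ℝ)
      ≤ 4 / (Fintype.card α : ℝ) * ∑ u ∈ S with G.Adj v u, (l * Fintype.card α : ℝ) := by
        gcongr with u _
        exact sum_forbiddenCount_le hg _
    _ = 4 * l * #{u ∈ S | G.Adj v u} := by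
        rw [sum_const, nsmul_eq_mul]; field_simp
    _ ≤ 4 * l * G.degree v := by
        gcongr
        exact card_filter_adj_le_degree S v

theorem sum_indicator_mem_edge_le (hg : ∀ x y, #(g x y) ≤ l) (hm : ∑ v, G.degree v = 2 * m)
    (S : Finset V) (φ : V → α) :
    ∑ x, ∑ u ∈ S, ∑ v ∈ S with G.Adj u v, (if x ∈ g (φ u) (φ v) then (1 : ℝ) else 0)
      ≤ 2 * l * m := by
  rw [sum_comm]
  have h (u : V) : ∑ x, ∑ v ∈ S with G.Adj u v, (if x ∈ g (φ u) (φ v) then (1 : ℝ) else 0)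
      ≤ G.degree u * l := by
    rw [sum_comm]
    calc _ ≤ ∑ v ∈ S with G.Adj u v, (l : ℝ) := by
          refine sum_le_sum fun v _ => ?_
          simpa using hg (φ u) (φ v)
      _ = #{v ∈ S | G.Adj u v} * l := by simp
      _ ≤ _ := by
          gcongr
          exact card_filter_adj_le_degree S u
  calc _ ≤ ∑ u ∈ S, (G.degree u * l : ℝ) := sum_le_sum fun u _ => h u
    _ ≤ ∑ u, (G.degree u * l : ℝ) :=
        sum_le_sum_of_subset_of_nonneg (subset_univ _) fun _ _ _ => by positivity
    _ = ((∑ u, G.degree u : ℕ) : ℝ) * l := by rw [← sum_mul]; push_cast; rfl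
    _ = 2 * l * m := by rw [hm]; push_cast; ring

/-! ### The invariant and one greedy step -/

variable [DecidableEq V]

variable (G g l m) in
/-- A partial embedding of the vertices in `S`, together with slacks `a v ∈ (0, 1]` of the other
vertices, which bound the number of points that are forbidden as an image of `v`. -/
structure IsGoodPartial (S : Finset V) (φ : V → α) (a : V → ℝ) : Prop where
  inj : Set.InjOn φ S
  free : ∀ u ∈ S, ∀ v ∈ S, G.Adj u v → ∀ w ∈ S, φ w ∉ g (φ u) (φ v)
  popularity_le : ∀ w ∈ S, (popularity g (φ w) : ℝ) ≤ 16 * l * Fintype.card α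
  slack_pos : ∀ v ∉ S, 0 < a v
  slack_le_one : ∀ v ∉ S, a v ≤ 1
  -- Two sources: a new image `φ w` facing older neighbours is charged to the slack; a newly placed
  -- neighbour of `v` facing all images costs at most `1024 l m / deg v`, hence `1024 l m` over all
  -- neighbours.
  forbidden_le : ∀ v ∉ S,
    ∑ u ∈ S with G.Adj v u, ∑ w ∈ S, (forbiddenCount g (φ u) (φ w) : ℝ) ≤
      Fintype.card α / 4 * (1 - a v) + #{u ∈ S | G.Adj v u} * (1024 * l * m / G.degree v)
  -- Twice the drop of the potential from `2m` pays `deg v` for each placed vertex.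
  ledger : ∀ v ∉ S,
    (#S * G.degree v : ℝ) ≤ 2 * (2 * m - ∑ v ∈ Sᶜ, (G.degree v : ℝ) / a v)

/-- Averaging over all points produces an image for `q` at which every penalty is small. -/
theorem IsGoodPartial.exists_image (hg : ∀ x y, #(g x y) ≤ l) (hl : 1 ≤ l) (hm1 : 1 ≤ m)
    (hm : ∑ v, G.degree v = 2 * m) (hdeg : ∀ v, 1 ≤ G.degree v)
    (hN : (2000 * l * m : ℝ) ≤ Fintype.card α) {S : Finset V} {φ : V → α} {a : V → ℝ}
    (h : IsGoodPartial G g l m S φ a) {q : V} (hq : q ∉ S)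
    (hmax : ∀ v ∉ S, (G.degree v : ℝ) / a v ≤ G.degree q / a q) :
    ∃ x : α, (∀ w ∈ S, φ w ≠ x) ∧
      (∀ u ∈ S, ∀ v ∈ S, G.Adj u v → x ∉ g (φ u) (φ v)) ∧
      (∀ u ∈ S, G.Adj q u → ∀ w ∈ S, φ w ∉ g (φ u) x) ∧
      (popularity g x : ℝ) ≤ 16 * l * Fintype.card α ∧
      ∑ w ∈ S, (forbiddenCount g x (φ w) : ℝ) ≤ 256 * l * (#S + 1) ∧
      (∀ v ∉ S, slackLoss G g S φ v x ≤ a v / 2) ∧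
      ∑ v ∈ Sᶜ, 2 * G.degree v / a v ^ 2 * slackLoss G g S φ v x ≤ G.degree q / a q / 2 := by
  have hlm : (1 : ℝ) ≤ l * m := by exact_mod_cast Nat.mul_pos hl hm1
  have hl' : (1 : ℝ) ≤ l := by exact_mod_cast hl
  have hN0 : (0 : ℝ) < Fintype.card α := by linarith
  have : Nonempty α := Fintype.card_pos_iff.1 (by exact_mod_cast hN0)
  have hdeg' (v : V) : (1 : ℝ) ≤ G.degree v := by exact_mod_cast hdeg v
  set N : ℝ := (Fintype.card α : ℝ) with hNdef
  set D : V → ℝ := fun v => (G.degree v : ℝ) / a v with hD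
  have hDq : 0 < D q := div_pos (by linarith [hdeg' q]) (h.slack_pos q hq)
  have hDnn (v : V) (hv : v ∈ Sᶜ) : 0 ≤ D v :=
    div_nonneg (by positivity) (h.slack_pos v (mem_compl.1 hv)).le
  have hlq := h.ledger q hq
  have hΨ0 : 0 ≤ ∑ v ∈ Sᶜ, D v := sum_nonneg hDnn
  have hΨ : ∑ v ∈ Sᶜ, D v ≤ 2 * m := by
    have : (0 : ℝ) ≤ #S * G.degree q := by positivity
    simp only [hD]; linarith
  have hS : (#S : ℝ) ≤ 4 * m := by
    have : (#S : ℝ) * 1 ≤ #S * G.degree q := by gcongr; exact hdeg' q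
    simp only [hD] at hΨ0
    linarith
  -- `T1`, `T2`, `T3` count violations; `T4` to `T7` are ratios of a quantity to its allowance. All
  -- are nonnegative, so a total below 1 meets every requirement.
  set T1 : α → ℝ := fun x => ∑ w ∈ S, (if φ w = x then (1 : ℝ) else 0) with hT1
  set T2 : α → ℝ := fun x => ∑ u ∈ S, ∑ v ∈ S with G.Adj u v,
    (if x ∈ g (φ u) (φ v) then (1 : ℝ) else 0) with hT2
  set T3 : α → ℝ := fun x => ∑ u ∈ S with G.Adj q u, ∑ w ∈ S,
    (if φ w ∈ g (φ u) x then (1 : ℝ) else 0) with hT3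
  set T4 : α → ℝ := fun x => (popularity g x : ℝ) / (16 * l * N) with hT4
  set T5 : α → ℝ := fun x => (∑ w ∈ S, (forbiddenCount g x (φ w) : ℝ)) / (256 * l * (#S + 1))
    with hT5
  set T6 : α → ℝ := fun x => ∑ v ∈ Sᶜ, 2 / a v * slackLoss G g S φ v x with hT6
  set T7 : α → ℝ := fun x => (∑ v ∈ Sᶜ, 2 * G.degree v / a v ^ 2 * slackLoss G g S φ v x) /
    (D q / 2) with hT7
  have n1 (x) : 0 ≤ T1 x := sum_nonneg fun _ _ => by positivity
  have n2 (x) : 0 ≤ T2 x := sum_nonneg fun _ _ => sum_nonneg fun _ _ => by positivity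
  have n3 (x) : 0 ≤ T3 x := sum_nonneg fun _ _ => sum_nonneg fun _ _ => by positivity
  have n4 (x) : 0 ≤ T4 x := by simp only [hT4]; positivity
  have n5 (x) : 0 ≤ T5 x := by simp only [hT5]; positivity
  have n6' (x) (v) (hv : v ∈ Sᶜ) : 0 ≤ 2 / a v * slackLoss G g S φ v x :=
    mul_nonneg (div_nonneg zero_le_two (h.slack_pos v (mem_compl.1 hv)).le)
      (slackLoss_nonneg _ _ _ _)
  have n6 (x) : 0 ≤ T6 x := sum_nonneg (n6' x)
  have n7 (x) : 0 ≤ T7 x := div_nonneg (sum_nonneg fun v _ =>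
    mul_nonneg (by positivity) (slackLoss_nonneg _ _ _ _)) (by linarith)
  have s1 : ∑ x, T1 x ≤ 4 * (l * m) := by
    rw [sum_indicator_eq_le]
    have : (m : ℝ) ≤ l * m := le_mul_of_one_le_left (by positivity) hl'
    linarith
  have s2 : ∑ x, T2 x ≤ 2 * (l * m) := by
    rw [← mul_assoc]; exact sum_indicator_mem_edge_le hg hm S φ
  have s3 : ∑ x, T3 x ≤ N / 4 + 1024 * (l * m) := by
    rw [sum_indicator_mem_new_edge]
    refine (h.forbidden_le q hq).trans ?_
    have e1 : N / 4 * (1 - a q) ≤ N / 4 :=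
      mul_le_of_le_one_right (by positivity) (by linarith [h.slack_pos q hq])
    have e2 : (#{u ∈ S | G.Adj q u} : ℝ) * (1024 * l * m / G.degree q) ≤
        G.degree q * (1024 * l * m / G.degree q) := by
      gcongr
      exact card_filter_adj_le_degree S q
    have e3 : (G.degree q : ℝ) * (1024 * l * m / G.degree q) = 1024 * (l * m) := by
      have := hdeg' q
      field_simp
    linarith
  have s4 : ∑ x, T4 x ≤ N / 16 := by
    simp only [hT4]
    rw [← sum_div, div_le_iff₀ (by positivity)]
    refine (sum_popularity_le hg).trans (le_of_eq ?_)
    rw [← hNdef]; ring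
  have s5 : ∑ x, T5 x ≤ N / 16 := by
    simp only [hT5]
    rw [← sum_div, div_le_iff₀ (by positivity), sum_sum_forbiddenCount_eq]
    -- Only unpopular points were used as images, which is what bounds this average.
    calc ∑ w ∈ S, (popularity g (φ w) : ℝ) ≤ ∑ _w ∈ S, 16 * l * N := sum_le_sum h.popularity_le
      _ = 16 * l * N * #S := by rw [sum_const, nsmul_eq_mul]; ring
      _ ≤ 16 * l * N * (#S + 1) := by gcongr; linarith
      _ = _ := by ring
  have s6 : ∑ x, T6 x ≤ 16 * (l * m) := by
    simp only [hT6]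
    rw [sum_comm]
    calc ∑ v ∈ Sᶜ, ∑ x, 2 / a v * slackLoss G g S φ v x ≤ ∑ v ∈ Sᶜ, 8 * l * D v := by
          refine sum_le_sum fun v hv => ?_
          rw [← mul_sum]
          have := h.slack_pos v (mem_compl.1 hv)
          calc _ ≤ 2 / a v * (4 * l * G.degree v) := by
                gcongr; exact sum_slackLoss_le hg S φ v
            _ = _ := by simp only [hD]; ring
      _ = 8 * l * ∑ v ∈ Sᶜ, D v := by rw [mul_sum]
      _ ≤ 8 * l * (2 * m) := by gcongr
      _ = _ := by ring
  have s7 : ∑ x, T7 x ≤ 32 * (l * m) := by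
    simp only [hT7]
    rw [← sum_div, div_le_iff₀ (by linarith), sum_comm]
    calc ∑ v ∈ Sᶜ, ∑ x, 2 * G.degree v / a v ^ 2 * slackLoss G g S φ v x
        ≤ ∑ v ∈ Sᶜ, 8 * l * D q * D v := by
          refine sum_le_sum fun v hv => ?_
          rw [← mul_sum]
          have hv' := mem_compl.1 hv
          have := h.slack_pos v hv'
          calc _ ≤ 2 * G.degree v / a v ^ 2 * (4 * l * G.degree v) := by
                gcongr; exact sum_slackLoss_le hg S φ v
            _ = 8 * l * D v * D v := by simp only [hD]; field_simp; ring
            -- Maximality of `q` turns the square of `D v` into `D q * D v`, so the sum stays linear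
            -- in the potential.
            _ ≤ _ := by
                have := hDnn v hv
                gcongr; exact hmax v hv'
      _ = 8 * l * D q * ∑ v ∈ Sᶜ, D v := by rw [mul_sum]
      _ ≤ 8 * l * D q * (2 * m) := by gcongr
      _ = _ := by ring
  obtain ⟨x, -, hx⟩ : ∃ x ∈ (univ : Finset α),
      T1 x + T2 x + T3 x + T4 x + T5 x + T6 x + T7 x < 1 := by
    refine exists_lt_of_sum_lt ?_
    simp only [sum_add_distrib, sum_const, card_univ, nsmul_eq_mul, mul_one]
    rw [← hNdef]
    -- The penalties sum to at most `3N/8 + 1078 l m`, which is below `N` since `N ≥ 2000 l m`.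
    linarith
  have := n1 x; have := n2 x; have := n3 x; have := n4 x; have := n5 x; have := n6 x
  have := n7 x
  refine ⟨x, fun w hw e => ?_, fun u hu v hv huv hmem => ?_, fun u hu hqu w hw hmem => ?_,
    ?_, ?_, fun v hv => ?_, ?_⟩
  · have h1 : (1 : ℝ) ≤ T1 x := by
      have := single_le_sum (f := fun w => if φ w = x then (1 : ℝ) else 0)
        (fun _ _ => by positivity) hw
      simp only [if_pos e] at this
      exact this
    linarith
  · have h1 : (1 : ℝ) ≤ T2 x := by
      have e1 := single_le_sum (f := fun u => ∑ v ∈ S with G.Adj u v,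
        (if x ∈ g (φ u) (φ v) then (1 : ℝ) else 0))
        (fun _ _ => sum_nonneg fun _ _ => by positivity) hu
      have e2 := single_le_sum (f := fun v => if x ∈ g (φ u) (φ v) then (1 : ℝ) else 0)
        (fun _ _ => by positivity) (mem_filter.2 ⟨hv, huv⟩)
      simp only [if_pos hmem] at e2
      exact e2.trans e1
    linarith
  · have h1 : (1 : ℝ) ≤ T3 x := by
      have e1 := single_le_sum (f := fun u => ∑ w ∈ S,
        (if φ w ∈ g (φ u) x then (1 : ℝ) else 0))
        (fun _ _ => sum_nonneg fun _ _ => by positivity) (mem_filter.2 ⟨hu, hqu⟩)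
      have e2 := single_le_sum (f := fun w => if φ w ∈ g (φ u) x then (1 : ℝ) else 0)
        (fun _ _ => by positivity) hw
      simp only [if_pos hmem] at e2
      exact e2.trans e1
    linarith
  · have h1 : T4 x ≤ 1 := by linarith
    simp only [hT4] at h1
    rwa [div_le_one (by positivity)] at h1
  · have h1 : T5 x ≤ 1 := by linarith
    simp only [hT5] at h1
    rwa [div_le_one (by positivity)] at h1
  · have h1 : 2 / a v * slackLoss G g S φ v x ≤ 1 :=
      (single_le_sum (n6' x) (mem_compl.2 hv)).trans (by linarith)
    have := h.slack_pos v hv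
    rw [div_mul_eq_mul_div, div_le_one this] at h1
    linarith
  · have h1 : T7 x ≤ 1 := by linarith
    simp only [hT7] at h1
    rwa [div_le_one (by linarith)] at h1

/-- Removing a vertex of maximal ratio of degree and slack pays for the slack lost by the rest. -/
theorem sum_degree_div_slack_le {S : Finset V} {a t : V → ℝ} {q : V} (hq : q ∉ S)
    (ha : ∀ v ∉ S, 0 < a v) (ht : ∀ v, 0 ≤ t v) (hta : ∀ v ∉ S, t v ≤ a v / 2)
    (hsum : ∑ v ∈ Sᶜ, 2 * G.degree v / a v ^ 2 * t v ≤ G.degree q / a q / 2) :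
    ∑ v ∈ (insert q S)ᶜ, (G.degree v : ℝ) / (a v - t v) ≤
      ∑ v ∈ Sᶜ, (G.degree v : ℝ) / a v - G.degree q / a q / 2 := by
  have hsub : (insert q S)ᶜ = Sᶜ.erase q := by
    ext v; simp
  have hqc : q ∈ Sᶜ := mem_compl.2 hq
  rw [hsub]
  have h1 : ∑ v ∈ Sᶜ.erase q, (G.degree v : ℝ) / (a v - t v) ≤
      ∑ v ∈ Sᶜ.erase q, ((G.degree v : ℝ) / a v + 2 * G.degree v / a v ^ 2 * t v) := by
    refine sum_le_sum fun v hv => ?_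
    have hv' := mem_compl.1 (mem_of_mem_erase hv)
    calc (G.degree v : ℝ) / (a v - t v) = G.degree v * (a v - t v)⁻¹ := div_eq_mul_inv _ _
      _ ≤ G.degree v * ((a v)⁻¹ + 2 * t v / a v ^ 2) := by
          gcongr; exact inv_sub_le_inv_add (ha v hv') (ht v) (hta v hv')
      _ = _ := by ring
  have h2 : ∑ v ∈ Sᶜ.erase q, 2 * G.degree v / a v ^ 2 * t v ≤
      ∑ v ∈ Sᶜ, 2 * G.degree v / a v ^ 2 * t v :=
    sum_le_sum_of_subset_of_nonneg (erase_subset _ _) fun v _ _ =>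
      mul_nonneg (by positivity) (ht v)
  rw [sum_add_distrib] at h1
  have h3 := add_sum_erase Sᶜ (fun v => (G.degree v : ℝ) / a v) hqc
  linarith

theorem IsGoodPartial.exists_insert (hg : ∀ x y, #(g x y) ≤ l) (hsymm : ∀ x y, g x y = g y x)
    (hself : ∀ x y, x ∉ g x y) (hl : 1 ≤ l) (hm1 : 1 ≤ m)
    (hm : ∑ v, G.degree v = 2 * m) (hdeg : ∀ v, 1 ≤ G.degree v)
    (hN : (2000 * l * m : ℝ) ≤ Fintype.card α) {S : Finset V} {φ : V → α} {a : V → ℝ}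
    (h : IsGoodPartial G g l m S φ a) (hS : S ≠ univ) :
    ∃ q ∉ S, ∃ φ' a', IsGoodPartial G g l m (insert q S) φ' a' := by
  have hne : Sᶜ.Nonempty := by
    rwa [nonempty_iff_ne_empty, Ne, compl_eq_empty_iff]
  obtain ⟨q, hqc, hmax⟩ := exists_max_image Sᶜ (fun v => (G.degree v : ℝ) / a v) hne
  have hq := mem_compl.1 hqc
  replace hmax : ∀ v ∉ S, (G.degree v : ℝ) / a v ≤ G.degree q / a q :=
    fun v hv => hmax v (mem_compl.2 hv)
  obtain ⟨x, x1, x2, x3, x4, x5, x6, x7⟩ := h.exists_image hg hl hm1 hm hdeg hN hq hmax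
  have hlm : (1 : ℝ) ≤ l * m := by exact_mod_cast Nat.mul_pos hl hm1
  have hN0 : (0 : ℝ) < Fintype.card α := by linarith
  have hdeg' (v : V) : (1 : ℝ) ≤ G.degree v := by exact_mod_cast hdeg v
  have hφ {w : V} (hw : w ∈ S) : Function.update φ q x w = φ w :=
    Function.update_of_ne (ne_of_mem_of_not_mem hw hq) _ _
  have hnn := slackLoss_nonneg (G := G) (g := g) S φ
  have hout {v : V} (hv : v ∉ insert q S) : v ≠ q ∧ v ∉ S := by simpa using hv
  have hΨ := sum_degree_div_slack_le (G := G) hq h.slack_pos (fun v => hnn v x) x6 x7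
  have hpos {v : V} (hv : v ∉ S) : 0 < a v - slackLoss G g S φ v x := by
    linarith [x6 v hv, h.slack_pos v hv]
  have hledger : ∀ v ∉ insert q S, (#(insert q S) * G.degree v : ℝ) ≤ 2 * (2 * m -
      ∑ v ∈ (insert q S)ᶜ, (G.degree v : ℝ) / (a v - slackLoss G g S φ v x)) := by
    intro v hv
    have hv' := (hout hv).2
    have e1 : (G.degree v : ℝ) ≤ G.degree v / a v :=
      le_div_self (by positivity) (h.slack_pos v hv') (h.slack_le_one v hv')
    rw [card_insert_of_notMem hq]
    push_cast
    -- The potential falls by at least `deg q / a q / 2 ≥ deg v / a v / 2 ≥ deg v / 2`; doubled,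
    -- this pays for the new vertex.
    linarith [h.ledger v hv', hmax v hv']
  refine ⟨q, hq, Function.update φ q x, fun v => a v - slackLoss G g S φ v x,
    ⟨?_, ?_, ?_, fun v hv => hpos (hout hv).2, fun v hv => ?_, fun v hv => ?_, hledger⟩⟩
  · intro u hu v hv e
    rcases mem_insert.1 (mem_coe.1 hu) with rfl | hu' <;>
      rcases mem_insert.1 (mem_coe.1 hv) with rfl | hv'
    · rfl
    · rw [Function.update_self, hφ hv'] at e
      exact absurd e.symm (x1 v hv')
    · rw [Function.update_self, hφ hu'] at e
      exact absurd e (x1 u hu')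
    · rw [hφ hu', hφ hv'] at e
      exact h.inj hu' hv' e
  · intro u hu v hv huv w hw
    have hself' : ∀ x y, y ∉ g x y := fun x y => hsymm x y ▸ hself y x
    rcases mem_insert.1 hu with rfl | hu' <;> rcases mem_insert.1 hv with rfl | hv' <;>
      rcases mem_insert.1 hw with rfl | hw'
    · exact absurd huv (G.loopless.irrefl _)
    · exact absurd huv (G.loopless.irrefl _)
    · exact hself _ _
    · rw [Function.update_self, hφ hv', hφ hw', hsymm]
      exact x3 v hv' huv w hw'
    · exact hself' _ _
    · rw [Function.update_self, hφ hu', hφ hw']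
      exact x3 u hu' huv.symm w hw'
    · rw [Function.update_self, hφ hu', hφ hv']
      exact x2 u hu' v hv' huv
    · rw [hφ hu', hφ hv', hφ hw']
      exact h.free u hu' v hv' huv w hw'
  · intro w hw
    rcases mem_insert.1 hw with rfl | hw'
    · rwa [Function.update_self]
    · rw [hφ hw']
      exact h.popularity_le w hw'
  · linarith [hnn v x, h.slack_le_one v (hout hv).2]
  · have hv' := (hout hv).2
    -- Old neighbours against the new image: the factor `4 / N` in `slackLoss` makes the slack
    -- absorb the increase exactly.
    have e0 : ∑ u ∈ S with G.Adj v u, ∑ w ∈ insert q S,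
        (forbiddenCount g (Function.update φ q x u) (Function.update φ q x w) : ℝ) ≤
        Fintype.card α / 4 * (1 - (a v - slackLoss G g S φ v x)) +
          #{u ∈ S | G.Adj v u} * (1024 * l * m / G.degree v) := by
      have e1 : ∑ u ∈ S with G.Adj v u, ∑ w ∈ insert q S,
          (forbiddenCount g (Function.update φ q x u) (Function.update φ q x w) : ℝ) =
          ∑ u ∈ S with G.Adj v u, (forbiddenCount g (φ u) x : ℝ) +
          ∑ u ∈ S with G.Adj v u, ∑ w ∈ S, (forbiddenCount g (φ u) (φ w) : ℝ) := by
        rw [← sum_add_distrib]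
        refine sum_congr rfl fun u hu => ?_
        rw [hφ (mem_filter.1 hu).1]
        exact sum_update_of_notMem hq x fun y => (forbiddenCount g (φ u) y : ℝ)
      have e2 : Fintype.card α / 4 * slackLoss G g S φ v x =
          ∑ u ∈ S with G.Adj v u, (forbiddenCount g (φ u) x : ℝ) := by
        unfold slackLoss; field_simp
      rw [e1, ← e2]
      linarith [h.forbidden_le v hv']
    rw [filter_insert]
    split_ifs with hvq
    · have hqf : q ∉ S.filter (G.Adj v) := fun hh => hq (mem_filter.1 hh).1
      rw [sum_insert hqf, card_insert_of_notMem hqf, Function.update_self]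
      have e3 : ∑ w ∈ insert q S, (forbiddenCount g x (Function.update φ q x w) : ℝ) ≤
          1024 * l * m / G.degree v := by
        rw [sum_update_of_notMem hq x fun y => (forbiddenCount g x y : ℝ),
          forbiddenCount_self hself, Nat.cast_zero, zero_add]
        refine x5.trans ?_
        -- With a nonnegative potential, the updated ledger reads `(#S + 1) * deg v ≤ 4m`; hence
        -- `1024 = 256 * 4`.
        have e4 := hledger v hv
        have e5 : 0 ≤ ∑ v ∈ (insert q S)ᶜ, (G.degree v : ℝ) / (a v - slackLoss G g S φ v x) :=
          sum_nonneg fun w hw => div_nonneg (by positivity)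
            (hpos (hout (mem_compl.1 hw)).2).le
        rw [card_insert_of_notMem hq] at e4
        push_cast at e4
        rw [le_div_iff₀ (by linarith [hdeg' v])]
        calc 256 * (l : ℝ) * (#S + 1) * G.degree v = 256 * l * ((#S + 1) * G.degree v) := by ring
          _ ≤ 256 * l * (4 * m) := 
              mul_le_mul_of_nonneg_left (by linarith) (by positivity)
          _ = _ := by ring
      push_cast
      linarith
    · exact e0

theorem exists_isGoodPartial_univ (hg : ∀ x y, #(g x y) ≤ l) (hsymm : ∀ x y, g x y = g y x)
    (hself : ∀ x y, x ∉ g x y) (hl : 1 ≤ l) (hm1 : 1 ≤ m)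
    (hm : ∑ v, G.degree v = 2 * m) (hdeg : ∀ v, 1 ≤ G.degree v)
    (hN : (2000 * l * m : ℝ) ≤ Fintype.card α) :
    ∃ φ a, IsGoodPartial G g l m univ φ a := by
  have hlm : (1 : ℝ) ≤ l * m := by exact_mod_cast Nat.mul_pos hl hm1
  have hN0 : (0 : ℝ) < Fintype.card α := by linarith
  obtain ⟨x₀⟩ : Nonempty α := Fintype.card_pos_iff.1 (by exact_mod_cast hN0)
  have key : ∀ k ≤ Fintype.card V, ∃ (S : Finset V) (φ : V → α) (a : V → ℝ),
      #S = k ∧ IsGoodPartial G g l m S φ a := by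
    intro k
    induction k with
    | zero =>
      intro _
      refine ⟨∅, fun _ => x₀, fun _ => 1, rfl, ?_⟩
      have : ∑ v, (G.degree v : ℝ) = 2 * m := by exact_mod_cast hm
      -- With all slacks 1 the potential is exactly `2m`, so the ledger starts at `0 ≤ 0`.
      constructor <;> simp [this]
    | succ k ih =>
      intro hk
      obtain ⟨S, φ, a, hS, h⟩ := ih (by omega)
      obtain ⟨q, hq, φ', a', h'⟩ := h.exists_insert hg hsymm hself hl hm1 hm hdeg hN (by
        rintro rfl
        rw [card_univ] at hS
        omega)
      exact ⟨insert q S, φ', a', by rw [card_insert_of_notMem hq, hS], h'⟩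
  obtain ⟨S, φ, a, hS, h⟩ := key _ le_rfl
  rw [card_eq_iff_eq_univ] at hS
  exact ⟨φ, a, hS ▸ h⟩

end Greedy

/-! ### Transfer to functions on two-element subsets -/

theorem pairOf_comm {α : Type*} [DecidableEq α] (a b : α) (h : a ≠ b) :
    pairOf a b h = pairOf b a h.symm :=
  Subtype.ext (Finset.pair_comm a b)

theorem theorem2 :
    ∃ C : ℝ, 0 < C ∧
      ∀ (m ℓ N : ℕ), 1 ≤ ℓ → C * (ℓ : ℝ) * (m : ℝ) ≤ (N : ℝ) →
      ∀ (V : Type*) [Finite V] (G : SimpleGraph V),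
        G.edgeSet.ncard = m → (∀ v : V, ¬ G.IsIsolated v) →
      ∀ f : Set.powersetCard (Fin N) 2 → Set.powersetCard (Fin N) ℓ,
        (∀ e, Disjoint (f e : Set (Fin N)) (e : Set (Fin N))) →
        ∃ φ : V ↪ Fin N, ∀ (u v : V) (h : G.Adj u v),
          Disjoint (f (pairOf (φ u) (φ v) (φ.injective.ne h.ne)) : Set (Fin N))
            (Set.range φ) := by
  classical
  refine ⟨2000, by norm_num, fun m l N hl hN V _ G hm hiso f hf => ?_⟩
  have := Fintype.ofFinite V
  have hsum : ∑ v, G.degree v = 2 * m := by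
    rw [G.sum_degrees_eq_twice_card_edges, ← hm, Set.ncard_eq_toFinset_card']
    rfl
  have hdeg (v : V) : 1 ≤ G.degree v := by
    have := hiso v
    rw [← G.degree_eq_zero] at this
    omega
  rcases Nat.eq_zero_or_pos m with rfl | hm1
  · have : IsEmpty V := ⟨fun v => by
      have h1 := Finset.single_le_sum (f := fun v => G.degree v) (fun _ _ => Nat.zero_le _)
        (Finset.mem_univ v)
      have h2 := hdeg v
      omega⟩
    exact ⟨Function.Embedding.ofIsEmpty, fun u => isEmptyElim u⟩
  -- The empty value on the diagonal keeps the size bound, the symmetry and `x ∉ g x y` valid for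
  -- all pairs.
  let g : Fin N → Fin N → Finset (Fin N) := fun x y =>
    if h : x ≠ y then (f (pairOf x y h) : Finset (Fin N)) else ∅
  have hg (x y) : (g x y).card ≤ l := by
    simp only [g]
    split_ifs with h
    · exact (f (pairOf x y h)).2.le
    · simp
  have hsymm (x y) : g x y = g y x := by
    by_cases h : x = y
    · rw [h]
    · simp only [g, dif_pos (show x ≠ y from h), dif_pos (show y ≠ x from Ne.symm h),
        pairOf_comm x y h]
  have hself (x y) : x ∉ g x y := by
    simp only [g]
    split_ifs with h
    · intro hx
      exact Set.disjoint_left.1 (hf (pairOf x y h)) hx (Finset.mem_insert_self x {y})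
    · simp
  obtain ⟨φ, a, h⟩ := exists_isGoodPartial_univ (G := G) hg hsymm hself hl hm1 hsum hdeg
    (by simpa using hN)
  have hinj : Function.Injective φ := by
    rw [← Set.injOn_univ]; simpa using h.inj
  refine ⟨⟨φ, hinj⟩, fun u v huv => Set.disjoint_right.2 ?_⟩
  rintro _ ⟨w, rfl⟩ hw
  refine h.free u (Finset.mem_univ u) v (Finset.mem_univ v) huv w (Finset.mem_univ w) ?_
  simp only [g, dif_pos (hinj.ne huv.ne)]
  exact hw
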